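/- Let $R$ be an associative ring with $1$ and let $I_0\supseteq I_1\supseteq I_2\supseteq\cdots$ be a descending chain of two-sided ideals of $R$ such that, for every $k\ge 0$, the ideal $I_k$ is idempotent, $I_k$ is finitely generated as a left ideal, and $R/I_k$ is semisimple artinian. For every $k\ge 0$ fix a finite nonempty set $G_k$ generating $I_k$ as a left ideal, and put $m_k=|G_k|$. For a right $R$-module $M$, the trace $\mathrm{Tr}(M)$ is the sum of the images of all homomorphisms $M\to R_R$. A countably generated projective right $R$-module $M$ is called *fair sized* if the set of two-sided ideals $I$ of $R$ such that $M/MI$ is finitely generated has a minimal element with respect to inclusion. For a sequence $s=(s_0,s_1,\dots)$ of positive integers define non-negative integers $\alpha_j=\alpha_j(s)$ by $\alpha_j=s_jn_j$, where $n_0=1$ and $n_{j+1}=m_{j+1}\,(n_j+\alpha_0+\cdots+\alpha_{j-1})$ for $j\ge 0$. Then, for all $k\ge 0$, the numbers $\alpha_0,\dots,\alpha_k$ determine $s_0,\dots,s_k$. Moreover, one can choose, for every sequence $s$ of positive integers, a countably generated projective right $R$-module $P_s$ with $\mathrm{Tr}(P_s)=I_0$ such that the following hold. (i) For every $k\ge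 0$ and every $s$, as right $R$-modules, $$P_s\otimes_R R/I_{k+1}\;\cong\; P_s/P_sI_{k+1}\;\cong\;(I_0/I_{k+1})^{\alpha_0}\oplus(I_1/I_{k+1})^{\alpha_1}\oplus\cdots\oplus(I_k/I_{k+1})^{\alpha_k}.$$ In particular, $P_s/P_sI_k$ is finitely generated for every $k\ge 0$. (ii) If $I_k\supsetneq I_{k+1}$ for every $k\ge 0$, then $P_s\cong P_{s'}$ implies $s=s'$. (iii) For every $k\ge 0$ and every $s$ there are right $R$-modules $Q_{k0},\dots,Q_{kk}$ with $P_s\cong Q_{k0}\oplus\cdots\oplus Q_{kk}$ and $\mathrm{Tr}(Q_{ki})=I_i$ for $i=0,\dots,k$. (iv) If $R_R$ is noetherian and $I_k\supsetneq I_{k+1}$ for every $k\ge 0$, then $P_s$ is not fair sized for any $s$. -/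

import Mathlib

/-! Right modules over a (not necessarily commutative) ring `R` are modules over `Rᵐᵒᵖ`,
with `MulOpposite.op r • x` standing for `x r`.  Two-sided ideals are left ideals
`I : Ideal R` together with the property `I.IsTwoSided`. -/

universe u v

namespace WhiteheadProj

section Modules

variable {R : Type u} [Ring R]

/-- A two-sided ideal of `R`, regarded as a submodule of the right module `R_R`. -/
def rightIdeal (I : Ideal R) [I.IsTwoSided] : Submodule Rᵐᵒᵖ R where
  carrier := {x | x ∈ I}
  add_mem' := fun ha hb => I.add_mem ha hb
  zero_mem' := I.zero_mem
  smul_mem' := fun c _ hx => I.mul_mem_right c.unop hx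

/-- The factor `I/J` of two-sided ideals as a right `R`-module (meant for `J ≤ I`). -/
abbrev IdealFactor (I J : Ideal R) [I.IsTwoSided] [J.IsTwoSided] : Type u :=
  rightIdeal I ⧸ (rightIdeal J).submoduleOf (rightIdeal I)

variable (M : Type v) [AddCommGroup M] [Module Rᵐᵒᵖ M]

/-- The submodule `M I` of a right module `M`, generated by all products `x a` with
`x ∈ M` and `a ∈ I`. -/
def mulIdeal (I : Ideal R) : Submodule Rᵐᵒᵖ M :=
  Submodule.span Rᵐᵒᵖ {y | ∃ x : M, ∃ a ∈ I, y = MulOpposite.op a • x}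

/-- The right module `M/MI`, that is, `M ⊗_R R/I`. -/
abbrev Reduction (I : Ideal R) : Type v := M ⧸ mulIdeal M I

variable (R)

/-- The trace of a right module: the sum of the images of all homomorphisms `M → R_R`. -/
def trace : Submodule Rᵐᵒᵖ R :=
  ⨆ f : M →ₗ[Rᵐᵒᵖ] R, LinearMap.range f

/-- A right module that is generated by a countable set. -/
def IsCountablyGenerated : Prop :=
  ∃ S : Set M, S.Countable ∧ Submodule.span Rᵐᵒᵖ S = ⊤

/-- The set of the two-sided ideals `I` of `R` such that `M/MI` is finitely generated. -/
def finiteReductionIdeals : Set (Ideal R) :=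
  {I | I.IsTwoSided ∧ Module.Finite Rᵐᵒᵖ (Reduction M I)}

/-- A (countably generated projective) right module `M` is fair sized if the set of the
two-sided ideals `I` with `M/MI` finitely generated has a minimal element. -/
def IsFairSized : Prop :=
  ∃ I : Ideal R, Minimal (fun J => J ∈ finiteReductionIdeals R M) I

end Modules

/-- The pair `(n_j, t_j)` given by `n_0 = 1`, `t_0 = 0`, `n_{j+1} = m_{j+1} (n_j + t_j)` and
`t_{j+1} = t_j + s_j n_j`. -/
def counts (m s : ℕ → ℕ) : ℕ → ℕ × ℕ
  | 0 => (1, 0)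
  | j + 1 => (m (j + 1) * ((counts m s j).1 + (counts m s j).2),
      (counts m s j).2 + s j * (counts m s j).1)

/-- The exponents `α_j = s_j n_j`, where `n_0 = 1` and
`n_{j+1} = m_{j+1} (n_j + α_0 + ⋯ + α_{j-1})`; see `alpha_zero` and `alpha_eq`. -/
def alpha (m s : ℕ → ℕ) (j : ℕ) : ℕ := s j * (counts m s j).1

theorem counts_snd (m s : ℕ → ℕ) (j : ℕ) :
    (counts m s j).2 = ∑ i ∈ Finset.range j, alpha m s i := by
  induction j with
  | zero => rfl
  | succ j ih => rw [Finset.sum_range_succ, ← ih]; rfl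

theorem alpha_zero (m s : ℕ → ℕ) : alpha m s 0 = s 0 := by simp [alpha, counts]

theorem alpha_eq (m s : ℕ → ℕ) (j : ℕ) :
    alpha m s (j + 1) = s (j + 1) * (m (j + 1) *
      ((counts m s j).1 + ∑ i ∈ Finset.range j, alpha m s i)) := by
  rw [← counts_snd]; rfl

end WhiteheadProj

/-! The modules `P_s` are colimits of sequences of finitely generated free right modules,
`F 0 → F 1 → F 2 → ⋯`, in the style of Whitehead.  If every transition map satisfies
`h ∘ f (n + 1) ∘ f n = f n` for some `h`, then the colimit is projective
(`Retractable.projective`) and an element `y` of `F n` dies in it only if `f n y = 0`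
(`Retractable.step_eq_zero`).

The basis of `F n` consists of the nodes at depth `n` of a tree.  A node at stage `k` has a level
`b ≤ k`.  Its children are one node of level `k + 1` for each `g` in the generating set
`G (k + 1)`, and `c` further nodes of level `b`, where `c = s_k` if `b = k` and `c = 1` otherwise.
The transition map multiplies the coordinate of a node by `g` on the way to the former and by
`E b k` on the way to the latter, where `E b k ∈ I b` lifts the central idempotent that generates
`I b/I (k + 1)` in the semisimple ring `R/I (k + 1)`.  The retractions `h` exist since
the products of two consecutive labels generate a left ideal containing `I (k + 2)`, by idempotency,
and hence also the labels at the first step (`IsTower.exists_functional_root`).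

Let `W b k` be the colimit for a tree whose root has level `b` and stage `k`, and `P_s = W 0 0`.

* Cutting a tree below its root gives `W b k ≅ (W b (k+1))^c ⊕ (W (k+1) (k+1))^(m_{k+1})`.
  Counting nodes, `P_s` is the sum of `α_i` copies of `W i k` for `i < k` and
  `n_k` copies of `W k k` (`IsTower.nonempty_equiv_stage`).
* The labels of the tree lie in `I b` and generate it, so `W b k` has trace `I b`
  (`IsTower.trace_treeModule`).
* Modulo `I k` all nodes but those of level `b < k` disappear and `W b k` reduces to
  `I b/I k` (`IsTower.exists_isReductionMap`).

The first two facts give the decompositions with prescribed traces, and the first and third the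
reductions modulo `I (k + 1)`.
Comparing the lengths of the reductions recovers the `α_k`, hence `s` (`multiplicity_unique`).
Finally let `R` be right noetherian and `J` minimal with `P_s/P_s J` finitely generated.  These
ideals are closed under products, so `J = I k * J ⊆ I k` for all `k`.  The preimages of the submodules
`(W k k) J` under the iterated projections `W 0 0 → W 1 1 → W 2 2 → ⋯` then form a strictly
increasing chain above `P_s J`, as the kernel of `W k k → W (k+1) (k+1)` has a summand `W k (k+1)` of
trace `I k ⊄ I (k+1)`, while `P_s/P_s J` is noetherian
(`IsTower.not_finite_reduction`). -/

universe w

namespace WhiteheadProj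

/-! ### Colimits of sequences of modules -/

section SeqColimit

variable {S : Type u} [Ring S]

/-- The colimit of a sequence `F 0 → F 1 → F 2 → ⋯` of modules, presented as the quotient of
the direct sum of the `F n` by the elements `f n y - y`. -/
abbrev SeqColimit (F : ℕ → Type v) [∀ n, AddCommGroup (F n)] [∀ n, Module S (F n)]
    (f : ∀ n, F n →ₗ[S] F (n + 1)) : Type v :=
  (DirectSum ℕ F) ⧸ Submodule.span S
    {x | ∃ n y, x = DirectSum.lof S ℕ F (n + 1) (f n y) - DirectSum.lof S ℕ F n y}

/-- A retractable sequence: every transition map is recovered from the composite of two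
consecutive ones.  This makes the colimit a direct summand of the direct sum of the terms. -/
def Retractable (F : ℕ → Type v) [∀ n, AddCommGroup (F n)] [∀ n, Module S (F n)]
    (f : ∀ n, F n →ₗ[S] F (n + 1)) : Prop :=
  ∀ n, ∃ h : F (n + 2) →ₗ[S] F (n + 1), ∀ y, h (f (n + 1) (f n y)) = f n y

namespace SeqColimit

variable {F : ℕ → Type v} [∀ n, AddCommGroup (F n)] [∀ n, Module S (F n)]
  {f : ∀ n, F n →ₗ[S] F (n + 1)}

variable (f) in
/-- The canonical map of the `n`-th term into the colimit. -/
def ι (n : ℕ) : F n →ₗ[S] SeqColimit F f :=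
  (Submodule.mkQ _).comp (DirectSum.lof S ℕ F n)

theorem ι_step (n : ℕ) (y : F n) : ι f (n + 1) (f n y) = ι f n y := by
  rw [← sub_eq_zero]
  simp only [ι, LinearMap.comp_apply, ← map_sub]
  exact (Submodule.Quotient.mk_eq_zero _).2 (Submodule.subset_span ⟨n, y, rfl⟩)

/-- A compatible family of maps out of the terms induces a map out of the colimit. -/
def lift {Q : Type w} [AddCommGroup Q] [Module S Q] (v : ∀ n, F n →ₗ[S] Q)
    (hv : ∀ n y, v (n + 1) (f n y) = v n y) : SeqColimit F f →ₗ[S] Q :=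
  Submodule.liftQ _ (DirectSum.toModule S ℕ Q v) (by
    rw [Submodule.span_le]
    rintro _ ⟨n, y, rfl⟩
    simp [hv])

@[simp] theorem lift_ι {Q : Type w} [AddCommGroup Q] [Module S Q] (v : ∀ n, F n →ₗ[S] Q)
    (hv : ∀ n y, v (n + 1) (f n y) = v n y) (n : ℕ) (y : F n) :
    lift v hv (ι f n y) = v n y := by
  simp [lift, ι]

theorem exists_ι_of_le {n m : ℕ} (h : n ≤ m) (y : F n) : ∃ y', ι f m y' = ι f n y := by
  induction m, h using Nat.le_induction with
  | base => exact ⟨y, rfl⟩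
  | succ m _ ih =>
    obtain ⟨y', hy'⟩ := ih
    exact ⟨f m y', by rw [ι_step, hy']⟩

theorem eventually_exists_ι (x : SeqColimit F f) :
    ∀ᶠ n in Filter.atTop, ∃ y, ι f n y = x := by
  suffices ∃ n y, ι f n y = x by
    obtain ⟨n, y, rfl⟩ := this
    filter_upwards [Filter.eventually_ge_atTop n] with m hm using exists_ι_of_le hm y
  obtain ⟨x, rfl⟩ := Submodule.mkQ_surjective _ x
  induction x using DirectSum.induction_on with
  | zero => exact ⟨0, 0, by simp⟩
  | of n y => exact ⟨n, y, rfl⟩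
  | add a b ha hb =>
    obtain ⟨n, y, hy⟩ := ha
    obtain ⟨m, z, hz⟩ := hb
    obtain ⟨y', hy'⟩ := exists_ι_of_le (f := f) (le_max_left n m) y
    obtain ⟨z', hz'⟩ := exists_ι_of_le (f := f) (le_max_right n m) z
    exact ⟨max n m, y' + z', by rw [map_add, map_add, hy', hz', hy, hz]⟩

theorem exists_ι (x : SeqColimit F f) : ∃ n y, ι f n y = x :=
  (eventually_exists_ι x).exists

theorem hom_ext {Q : Type w} [AddCommGroup Q] [Module S Q] {p q : SeqColimit F f →ₗ[S] Q}
    (h : ∀ n y, p (ι f n y) = q (ι f n y)) : p = q := by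
  refine LinearMap.ext fun x => ?_
  obtain ⟨n, y, rfl⟩ := exists_ι x
  exact h n y

end SeqColimit

open SeqColimit

/-- The transition map `f n` of a retractable sequence extends to a compatible family on all
terms. Beyond the `n`-th term the maps are `h_n ∘ ⋯ ∘ h_{n+k-1} ∘ f_{n+k}` for a choice of
retractions `h_i` with `h_i ∘ f_{i+1} ∘ f_i = f_i`. -/
theorem Retractable.exists_compatible (n : ℕ) {F : ℕ → Type v} [∀ n, AddCommGroup (F n)]
    [∀ n, Module S (F n)] {f : ∀ n, F n →ₗ[S] F (n + 1)} (hf : Retractable F f) :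
    ∃ p : ∀ k, F k →ₗ[S] F (n + 1), (∀ k y, p (k + 1) (f k y) = p k y) ∧ p n = f n := by
  induction n generalizing F with
  | zero =>
    choose h hh using hf
    let Ψ : ∀ k, F (k + 1) →ₗ[S] F 1 := fun k =>
      Nat.rec LinearMap.id (fun k ψ => ψ.comp (h k)) k
    refine ⟨fun k => (Ψ k).comp (f k), fun k y => ?_, rfl⟩
    change Ψ k (h k (f (k + 1) (f k y))) = Ψ k (f k y)
    rw [hh]
  | succ n ih =>
    obtain ⟨p, hp, hpn⟩ := ih (F := fun k => F (k + 1)) (f := fun k => f (k + 1))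
      (fun k => hf (k + 1))
    refine ⟨fun k => match k with
      | 0 => (p 0).comp (f 0)
      | k + 1 => p k, fun k y => ?_, hpn⟩
    cases k with
    | zero => rfl
    | succ k => exact hp k y

section

variable {F : ℕ → Type v} [∀ n, AddCommGroup (F n)] [∀ n, Module S (F n)]
  {f : ∀ n, F n →ₗ[S] F (n + 1)}

theorem Retractable.exists_extension (hf : Retractable F f) (n : ℕ) :
    ∃ π : SeqColimit F f →ₗ[S] F (n + 1), ∀ y, π (ι f n y) = f n y := by
  obtain ⟨p, hp, hpn⟩ := hf.exists_compatible n
  exact ⟨lift p hp, fun y => by rw [lift_ι, hpn]⟩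

theorem Retractable.step_eq_zero (hf : Retractable F f) {n : ℕ} {y : F n}
    (hy : ι f n y = 0) : f n y = 0 := by
  obtain ⟨π, hπ⟩ := hf.exists_extension n
  rw [← hπ, hy, map_zero]

/-- The colimit of a retractable sequence is projective when all terms are: if
`π n` extends `f n` to the colimit, then the maps `π n - f n ∘ π (n - 1)` are the components of
a section of `⨁ F (n + 1) → colim F`. -/
theorem Retractable.projective (hf : Retractable F f) [∀ n, Module.Projective S (F n)] :
    Module.Projective S (SeqColimit F f) := by
  choose π hπ using hf.exists_extension
  let D : ∀ n, SeqColimit F f →ₗ[S] F (n + 1) := fun n => match n with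
    | 0 => π 0
    | n + 1 => π (n + 1) - (f (n + 1)).comp (π n)
  let σ : ∀ k, F k →ₗ[S] DirectSum ℕ (fun n => F (n + 1)) := fun k =>
    ∑ n ∈ Finset.range (k + 1),
      (DirectSum.lof S ℕ (fun n => F (n + 1)) n).comp ((D n).comp (ι f k))
  have hσ : ∀ k y, σ (k + 1) (f k y) = σ k y := by
    intro k y
    have hD : D (k + 1) (ι f k y) = 0 := by
      have := hπ (k + 1) (f k y)
      rw [ι_step] at this
      simp [D, this, hπ]
    simp only [σ, LinearMap.sum_apply, LinearMap.comp_apply, ι_step]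
    rw [Finset.sum_range_succ, hD, map_zero, add_zero]
  refine Module.Projective.of_split (lift σ hσ)
    (DirectSum.toModule S ℕ _ (fun n => ι f (n + 1))) (hom_ext fun k y => ?_)
  have key : ∀ N x, ∑ n ∈ Finset.range (N + 1), ι f (n + 1) (D n x) = ι f (N + 1) (π N x) := by
    intro N x
    induction N with
    | zero => simp [D]
    | succ N ih =>
      rw [Finset.sum_range_succ, ih]
      simp [D, ι_step]
  simp only [LinearMap.comp_apply, lift_ι, LinearMap.id_apply]
  simp only [σ, LinearMap.sum_apply, LinearMap.comp_apply, map_sum, DirectSum.toModule_lof]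
  rw [key, hπ, ι_step]

/-- A recognition principle: a module receiving compatible maps from the terms of the sequence
that are jointly surjective and have kernels no larger than those of the `f n` is the colimit. -/
theorem SeqColimit.nonempty_equiv {Q : Type w} [AddCommGroup Q] [Module S Q]
    (v : ∀ n, F n →ₗ[S] Q) (hv : ∀ n y, v (n + 1) (f n y) = v n y)
    (hsurj : ∀ q, ∃ n y, v n y = q) (hker : ∀ n y, v n y = 0 → f n y = 0) :
    ∃ e : SeqColimit F f ≃ₗ[S] Q, ∀ n y, e (ι f n y) = v n y := by
  have hb : Function.Bijective (lift v hv) := by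
    constructor
    · rw [injective_iff_map_eq_zero]
      intro x hx
      obtain ⟨n, y, rfl⟩ := exists_ι x
      rw [lift_ι] at hx
      rw [← ι_step, hker n y hx, map_zero]
    · intro q
      obtain ⟨n, y, rfl⟩ := hsurj q
      exact ⟨ι f n y, lift_ι v hv n y⟩
  exact ⟨LinearEquiv.ofBijective (lift v hv) hb, fun n y => lift_ι v hv n y⟩

end

end SeqColimit

/-! ### Reductions, traces and lifted central idempotents -/

section Generalities

variable {R : Type u} [Ring R]

section Reduction

variable {M : Type v} [AddCommGroup M] [Module Rᵐᵒᵖ M] {N : Type w} [AddCommGroup N]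
  [Module Rᵐᵒᵖ N]

theorem op_smul_mem_mulIdeal {I : Ideal R} (x : M) {a : R} (ha : a ∈ I) :
    MulOpposite.op a • x ∈ mulIdeal M I :=
  Submodule.subset_span ⟨x, a, ha, rfl⟩

theorem mulIdeal_le_iff {I : Ideal R} {L : Submodule Rᵐᵒᵖ M} :
    mulIdeal M I ≤ L ↔ ∀ x : M, ∀ a ∈ I, MulOpposite.op a • x ∈ L := by
  refine Submodule.span_le.trans ⟨fun h x a ha => h ⟨x, a, ha, rfl⟩, ?_⟩
  rintro h _ ⟨x, a, ha, rfl⟩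
  exact h x a ha

theorem mulIdeal_mono {I J : Ideal R} (h : I ≤ J) : mulIdeal M I ≤ mulIdeal M J :=
  mulIdeal_le_iff.2 fun x _ ha => op_smul_mem_mulIdeal x (h ha)

theorem map_mem_mulIdeal {I : Ideal R} (f : M →ₗ[Rᵐᵒᵖ] N) {x : M} (hx : x ∈ mulIdeal M I) :
    f x ∈ mulIdeal N I := by
  suffices mulIdeal M I ≤ (mulIdeal N I).comap f from this hx
  refine mulIdeal_le_iff.2 fun x a ha => ?_
  rw [Submodule.mem_comap, map_smul]
  exact op_smul_mem_mulIdeal _ ha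

theorem mulIdeal_self_le (I : Ideal R) [I.IsTwoSided] : mulIdeal R I ≤ rightIdeal I :=
  mulIdeal_le_iff.2 fun x _ ha => I.mul_mem_left x ha

theorem mem_mulIdeal_of_equiv {I : Ideal R} (e : M ≃ₗ[Rᵐᵒᵖ] N) {x : M}
    (h : e x ∈ mulIdeal N I) : x ∈ mulIdeal M I := by
  simpa using map_mem_mulIdeal e.symm.toLinearMap h

theorem nonempty_reduction_equiv (I : Ideal R) (e : M ≃ₗ[Rᵐᵒᵖ] N) :
    Nonempty (Reduction M I ≃ₗ[Rᵐᵒᵖ] Reduction N I) := by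
  refine ⟨Submodule.Quotient.equiv _ _ e (le_antisymm ?_ fun y hy => ?_)⟩
  · exact Submodule.map_le_iff_le_comap.2 fun x hx => map_mem_mulIdeal e.toLinearMap hx
  · exact ⟨e.symm y, map_mem_mulIdeal e.symm.toLinearMap hy, e.apply_symm_apply y⟩

theorem mem_mulIdeal_prod {I : Ideal R} {x : M × N} (h₁ : x.1 ∈ mulIdeal M I)
    (h₂ : x.2 ∈ mulIdeal N I) : x ∈ mulIdeal (M × N) I := by
  have h := add_mem (map_mem_mulIdeal (LinearMap.inl Rᵐᵒᵖ M N) h₁)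
    (map_mem_mulIdeal (LinearMap.inr Rᵐᵒᵖ M N) h₂)
  simpa using h

theorem mem_mulIdeal_pi {X : Type*} [Finite X] {M : X → Type v} [∀ i, AddCommGroup (M i)]
    [∀ i, Module Rᵐᵒᵖ (M i)] {I : Ideal R} {x : ∀ i, M i} :
    x ∈ mulIdeal (∀ i, M i) I ↔ ∀ i, x i ∈ mulIdeal (M i) I := by
  classical
  cases nonempty_fintype X
  refine ⟨fun h i => map_mem_mulIdeal (LinearMap.proj i) h, fun h => ?_⟩
  rw [← Finset.univ_sum_single x]
  exact sum_mem fun i _ => map_mem_mulIdeal (LinearMap.single Rᵐᵒᵖ M i) (h i)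

theorem mem_mulIdeal_fun {X : Type*} [Finite X] {I : Ideal R} {y : X → R}
    (h : ∀ z, y z ∈ I) : y ∈ mulIdeal (X → R) I :=
  mem_mulIdeal_pi.2 fun z => by simpa using op_smul_mem_mulIdeal (1 : R) (h z)

section IsReductionMap

variable {N : Type w} [AddCommMonoid N] [Module Rᵐᵒᵖ N]

/-- A surjection `M → N` whose kernel is contained in `M I`.  If `I` annihilates `N`, the kernel
equals `M I`, so that the map exhibits `N` as the reduction `M/MI`. -/
def IsReductionMap (I : Ideal R) (φ : M →ₗ[Rᵐᵒᵖ] N) : Prop :=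
  Function.Surjective φ ∧ ∀ x, φ x = 0 → x ∈ mulIdeal M I

theorem mulIdeal_le_of_forall {I : Ideal R} (φ : M →ₗ[Rᵐᵒᵖ] N)
    (hN : ∀ y : N, ∀ a ∈ I, MulOpposite.op a • y = 0) {x : M} (hx : x ∈ mulIdeal M I) :
    φ x = 0 := by
  suffices mulIdeal M I ≤ LinearMap.ker φ from this hx
  exact mulIdeal_le_iff.2 fun x a ha => by rw [LinearMap.mem_ker, map_smul, hN _ a ha]

theorem IsReductionMap.nonempty_equiv {I : Ideal R} {φ : M →ₗ[Rᵐᵒᵖ] N}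
    (h : IsReductionMap I φ) (hN : ∀ y : N, ∀ a ∈ I, MulOpposite.op a • y = 0) :
    Nonempty (Reduction M I ≃ₗ[Rᵐᵒᵖ] N) := by
  let _ : AddCommGroup N := Module.addCommMonoidToAddCommGroup Rᵐᵒᵖ
  have : mulIdeal M I = LinearMap.ker φ :=
    le_antisymm (fun x hx => mulIdeal_le_of_forall φ hN hx) fun x hx => h.2 x hx
  exact ⟨(Submodule.quotEquivOfEq _ _ this).trans (φ.quotKerEquivOfSurjective h.1)⟩

theorem IsReductionMap.pi {X : Type*} [Finite X] {I : Ideal R} {M : X → Type v} {N : X → Type w}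
    [∀ i, AddCommGroup (M i)] [∀ i, Module Rᵐᵒᵖ (M i)]
    [∀ i, AddCommMonoid (N i)] [∀ i, Module Rᵐᵒᵖ (N i)]
    {φ : ∀ i, M i →ₗ[Rᵐᵒᵖ] N i} (h : ∀ i, IsReductionMap I (φ i)) :
    IsReductionMap I (LinearMap.pi fun i => (φ i).comp (LinearMap.proj i)) := by
  refine ⟨fun y => ?_, fun x hx => mem_mulIdeal_pi.2 fun i => (h i).2 _ (congrFun hx i)⟩
  choose x hx using fun i => (h i).1 (y i)
  exact ⟨x, funext hx⟩

end IsReductionMap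

end Reduction

section Trace

variable {M : Type v} [AddCommGroup M] [Module Rᵐᵒᵖ M]

theorem apply_mem_trace (φ : M →ₗ[Rᵐᵒᵖ] R) (x : M) : φ x ∈ trace R M :=
  Submodule.mem_iSup_of_mem φ ⟨x, rfl⟩

theorem trace_le_iff {L : Submodule Rᵐᵒᵖ R} :
    trace R M ≤ L ↔ ∀ (φ : M →ₗ[Rᵐᵒᵖ] R) (x : M), φ x ∈ L := by
  simp only [trace, iSup_le_iff, LinearMap.range_le_iff_comap, Submodule.eq_top_iff']
  rfl

theorem mul_mem_trace (r : R) {a : R} (ha : a ∈ trace R M) : r * a ∈ trace R M := by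
  let L : R →ₗ[Rᵐᵒᵖ] R :=
    { toFun := fun x => r * x
      map_add' := mul_add r
      map_smul' := fun c x => (mul_assoc r x c.unop).symm }
  suffices trace R M ≤ (trace R M).comap L from this ha
  exact trace_le_iff.2 fun φ x => apply_mem_trace (L.comp φ) x

theorem trace_le_of_mulIdeal_eq_top {I : Ideal R} [I.IsTwoSided] (h : mulIdeal M I = ⊤) :
    trace R M ≤ rightIdeal I :=
  trace_le_iff.2 fun φ x =>
    mulIdeal_self_le I (map_mem_mulIdeal φ (h ▸ Submodule.mem_top : x ∈ mulIdeal M I))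

theorem trace_pi {X : Type*} [Finite X] [Nonempty X] : trace R (X → M) = trace R M := by
  classical
  cases nonempty_fintype X
  apply le_antisymm
  · refine trace_le_iff.2 fun φ x => ?_
    rw [← Finset.univ_sum_single x, map_sum]
    exact sum_mem fun i _ =>
      apply_mem_trace (φ.comp (LinearMap.single Rᵐᵒᵖ (fun _ : X => M) i)) (x i)
  · refine trace_le_iff.2 fun φ x => ?_
    exact apply_mem_trace (M := X → M)
      (φ.comp (LinearMap.proj (Classical.arbitrary X))) (fun _ => x)

end Trace

section Semisimple

theorem exists_right_identity [IsSemisimpleRing R] (K : Ideal R) :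
    ∃ e ∈ K, ∀ x ∈ K, x * e = x := by
  obtain ⟨J, hJ⟩ := exists_isCompl K
  obtain ⟨e, he, f, hf, hef⟩ := Submodule.mem_sup.1
    (hJ.sup_eq_top.symm ▸ Submodule.mem_top : (1 : R) ∈ K ⊔ J)
  refine ⟨e, he, fun x hx => ?_⟩
  have hxf : x * f = x - x * e := by rw [eq_sub_iff_add_eq, add_comm, ← mul_add, hef, mul_one]
  have h0 : x - x * e ∈ K ⊓ J :=
    ⟨K.sub_mem hx (K.mul_mem_left x he), hxf ▸ J.mul_mem_left x hf⟩
  rw [hJ.inf_eq_bot, Submodule.mem_bot, sub_eq_zero] at h0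
  exact h0.symm

/-- A two-sided ideal of a semisimple ring has a right identity, and a left one by passing to the
opposite ring; the two coincide. -/
theorem exists_identity [IsSemisimpleRing R] (K : Ideal R) [K.IsTwoSided] :
    ∃ e ∈ K, ∀ x ∈ K, e * x = x ∧ x * e = x := by
  obtain ⟨e, he, hxe⟩ := exists_right_identity K
  let K' : Ideal Rᵐᵒᵖ :=
    { carrier := {x | x.unop ∈ K}
      add_mem' := fun ha hb => K.add_mem ha hb
      zero_mem' := K.zero_mem
      smul_mem' := fun c _ hx => K.mul_mem_right c.unop hx }
  obtain ⟨e', he', hxe'⟩ := exists_right_identity K'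
  have h1 : ∀ x ∈ K, e'.unop * x = x := fun x hx =>
    congrArg MulOpposite.unop (hxe' (MulOpposite.op x) hx)
  have h2 : e'.unop = e := (hxe _ he').symm.trans (h1 e he)
  exact ⟨e, he, fun x hx => ⟨h2 ▸ h1 x hx, hxe x hx⟩⟩

/-- A lift of the central idempotent that generates `I/J` in the semisimple ring `R/J`. -/
theorem exists_identity_mod (I J : Ideal R) [I.IsTwoSided] [J.IsTwoSided]
    [IsSemisimpleRing (R ⧸ J)] :
    ∃ e ∈ I, ∀ x ∈ I, e * x - x ∈ J ∧ x * e - x ∈ J := by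
  have hs : Function.Surjective (Ideal.Quotient.mk J) := Ideal.Quotient.mk_surjective
  have hK : (I.map (Ideal.Quotient.mk J)).IsTwoSided := by
    refine ⟨fun {a} b ha => ?_⟩
    obtain ⟨a, ha', rfl⟩ := (Ideal.mem_map_iff_of_surjective _ hs).1 ha
    obtain ⟨b, rfl⟩ := hs b
    exact map_mul (Ideal.Quotient.mk J) a b ▸ Ideal.mem_map_of_mem _ (I.mul_mem_right b ha')
  obtain ⟨e, he, h⟩ := exists_identity (I.map (Ideal.Quotient.mk J))
  obtain ⟨e, he', rfl⟩ := (Ideal.mem_map_iff_of_surjective _ hs).1 he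
  refine ⟨e, he', fun x hx => ?_⟩
  simpa [← Ideal.Quotient.eq] using h _ (Ideal.mem_map_of_mem (Ideal.Quotient.mk J) hx)

/-- The map `I/J → R/J` embeds the submodules of `I/J` into those of the semisimple ring
`(R/J)ᵐᵒᵖ` over itself. -/
theorem isFiniteLength_idealFactor (I J : Ideal R) [I.IsTwoSided] [J.IsTwoSided]
    [IsSemisimpleRing (R ⧸ J)] : IsFiniteLength Rᵐᵒᵖ (IdealFactor I J) := by
  let σ : Rᵐᵒᵖ →+* (R ⧸ J)ᵐᵒᵖ := (Ideal.Quotient.mk J).op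
  have : RingHomSurjective σ := ⟨fun x => by
    obtain ⟨y, hy⟩ := Ideal.Quotient.mk_surjective x.unop
    exact ⟨MulOpposite.op y, congrArg MulOpposite.op hy⟩⟩
  let f₀ : rightIdeal I →ₛₗ[σ] (R ⧸ J)ᵐᵒᵖ :=
    { toFun := fun x => MulOpposite.op (Ideal.Quotient.mk J x.1)
      map_add' := fun x y => congrArg MulOpposite.op (map_add (Ideal.Quotient.mk J) x.1 y.1)
      map_smul' := fun c x =>
        congrArg MulOpposite.op (map_mul (Ideal.Quotient.mk J) x.1 c.unop) }
  have hf₀ : ∀ x, f₀ x = 0 ↔ x ∈ (rightIdeal J).submoduleOf (rightIdeal I) := fun x =>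
    (MulOpposite.op_eq_zero_iff _).trans Ideal.Quotient.eq_zero_iff_mem
  let f : IdealFactor I J →ₛₗ[σ] (R ⧸ J)ᵐᵒᵖ := Submodule.liftQ _ f₀ fun x hx => (hf₀ x).2 hx
  have hf : Function.Injective f := by
    rw [injective_iff_map_eq_zero]
    intro x hx
    obtain ⟨x, rfl⟩ := Submodule.mkQ_surjective _ x
    exact (Submodule.Quotient.mk_eq_zero _).2 ((hf₀ x).1 hx)
  have hmono : StrictMono (Submodule.map f) := Submodule.map_strictMono_of_injective hf
  have h1 : IsNoetherian Rᵐᵒᵖ (IdealFactor I J) :=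
    isNoetherian_mk ⟨Subrelation.wf (fun h => hmono h)
      (InvImage.wf (Submodule.map f) (IsWellFounded.wf (r := (· > ·))))⟩
  have h2 : IsArtinian Rᵐᵒᵖ (IdealFactor I J) :=
    ⟨Subrelation.wf (fun h => hmono h) (InvImage.wf (Submodule.map f) IsWellFounded.wf)⟩
  exact isFiniteLength_iff_isNoetherian_isArtinian.2 ⟨h1, h2⟩

end Semisimple

end Generalities

/-! ### The tree of free modules -/

section Tree

variable {R : Type u} [Ring R] (G : ℕ → Finset R) (s : ℕ → ℕ) (E : ℕ → ℕ → R)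

/-- The number of children of the same level of a node of level `b` at stage `k`. -/
def copies (b k : ℕ) : ℕ := if b = k then s k else 1

/-- The nodes at depth `d` of the tree whose root has level `b` and sits at stage `k`.  The
children of the root sit at stage `k + 1`: there are `copies s b k` of level `b` and one of
level `k + 1` for each element of `G (k + 1)`. -/
def Node : ℕ → ℕ → ℕ → Type u
  | 0 => fun _ _ => PUnit
  | d + 1 => fun b k => (Fin (copies s b k) × Node d b (k + 1)) ⊕
      (G (k + 1) × Node d (k + 1) (k + 1))

namespace Node

instance : ∀ d b k, Finite (Node G s d b k)
  | 0, _, _ => inferInstanceAs (Finite PUnit)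
  | d + 1, b, k =>
    have := instFinite d b (k + 1)
    have := instFinite d (k + 1) (k + 1)
    inferInstanceAs (Finite ((Fin (copies s b k) × Node G s d b (k + 1)) ⊕
      (G (k + 1) × Node G s d (k + 1) (k + 1))))

variable {G s}

/-- The parent of a node. -/
def parent : ∀ {d b k}, Node G s (d + 1) b k → Node G s d b k
  | 0, _, _, _ => PUnit.unit
  | _ + 1, _, _, Sum.inl (i, x) => Sum.inl (i, parent x)
  | _ + 1, _, _, Sum.inr (g, x) => Sum.inr (g, parent x)

/-- The label of the edge from a node to its parent: `E b k` if both have level `b` and the parent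
sits at stage `k`, and the element of `G (k + 1)` that indexes the node otherwise. -/
def label : ∀ {d b k}, Node G s (d + 1) b k → R
  | 0, b, k, Sum.inl _ => E b k
  | 0, _, _, Sum.inr (g, _) => g
  | _ + 1, _, _, Sum.inl (_, x) => label x
  | _ + 1, _, _, Sum.inr (_, x) => label x

end Node

/-- The map of free right modules that sends the basis element of a node to the sum of the basis
elements of its children, each multiplied from the left by its edge label. -/
def step (d b k : ℕ) : (Node G s d b k → R) →ₗ[Rᵐᵒᵖ] (Node G s (d + 1) b k → R) where
  toFun y z := z.label E * y z.parent
  map_add' x y := funext fun z => mul_add _ (x z.parent) (y z.parent)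
  map_smul' c y := funext fun z => (mul_assoc (z.label E) (y z.parent) c.unop).symm

/-- The right module of the tree with a root of level `b` at stage `k`: the colimit of the free
modules on the nodes of depth `0, 1, 2, …`. -/
abbrev TreeModule (b k : ℕ) : Type u :=
  SeqColimit (fun d => Node G s d b k → R) (fun d => step G s E d b k)

/-- The map `R → TreeModule` given by the root. -/
def root (b k : ℕ) : R →ₗ[Rᵐᵒᵖ] TreeModule G s E b k :=
  (SeqColimit.ι (fun d => step G s E d b k) 0).comp (LinearMap.pi fun _ => LinearMap.id)

/-- Restriction of a function on the nodes to a subtree whose root is a child of level `b`. -/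
def restrictOld (d b k : ℕ) (i : Fin (copies s b k)) :
    (Node G s (d + 1) b k → R) →ₗ[Rᵐᵒᵖ] (Node G s d b (k + 1) → R) :=
  LinearMap.funLeft Rᵐᵒᵖ R fun x => Sum.inl (i, x)

/-- Restriction of a function on the nodes to a subtree whose root is a child of level `k + 1`. -/
def restrictNew (d b k : ℕ) (g : G (k + 1)) :
    (Node G s (d + 1) b k → R) →ₗ[Rᵐᵒᵖ] (Node G s d (k + 1) (k + 1) → R) :=
  LinearMap.funLeft Rᵐᵒᵖ R fun x => Sum.inr (g, x)

variable (I : ℕ → Ideal R)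

/-- The properties of the chain of ideals and of the labels on which the construction rests:
`E b k` is an element of `I b` that acts modulo `I (k + 1)` as an identity on `I b`. -/
structure IsTower : Prop where
  anti : Antitone I
  idem : ∀ k, I k * I k = I k
  span : ∀ k, Ideal.span (G k : Set R) = I k
  pos : ∀ k, 0 < s k
  mem : ∀ {b k}, b ≤ k → E b k ∈ I b
  left : ∀ {b k}, b ≤ k → ∀ x ∈ I b, E b k * x - x ∈ I (k + 1)
  right : ∀ {b k}, b ≤ k → ∀ x ∈ I b, x * E b k - x ∈ I (k + 1)

variable {G s E I}

namespace IsTower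

theorem copies_pos (h : IsTower G s E I) (b k : ℕ) : 0 < copies s b k := by
  unfold copies
  split_ifs
  exacts [h.pos k, one_pos]

theorem mem_of_mem_G (h : IsTower G s E I) {k : ℕ} (g : G k) : (g : R) ∈ I k :=
  h.span k ▸ Ideal.subset_span g.2

theorem label_mem (h : IsTower G s E I) : ∀ {d b k}, b ≤ k → ∀ z : Node G s (d + 1) b k,
    z.label E ∈ I b
  | 0, _, _, hb, Sum.inl _ => h.mem hb
  | 0, _, _, hb, Sum.inr (g, _) => h.anti (hb.trans (Nat.le_succ _)) (h.mem_of_mem_G g)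
  | _ + 1, _, _, hb, Sum.inl (_, x) => label_mem h (hb.trans (Nat.le_succ _)) x
  | _ + 1, _, _, hb, Sum.inr (_, x) =>
    h.anti (hb.trans (Nat.le_succ _)) (label_mem h le_rfl x)

variable [∀ k, (I k).IsTwoSided]

/-- At the root, the elements `a` for which left multiplication by `a` factors through the first
two transition maps form a left ideal.  It contains `g' * g` for `g ∈ G (k + 1)` and
`g' ∈ G (k + 2)`, hence all of `I (k + 2) * I (k + 1) = I (k + 2)`; so it contains the labels of the
edges at the root, as they agree modulo `I (k + 2)` with products of labels. -/
theorem exists_functional_root (h : IsTower G s E I) {b k : ℕ} (hb : b ≤ k)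
    (y : Node G s 1 b k) :
    ∃ φ : (Node G s 2 b k → R) →ₗ[Rᵐᵒᵖ] R, ∀ v : Node G s 0 b k → R,
      φ (step G s E 1 b k (step G s E 0 b k v)) = step G s E 0 b k v y := by
  let L : Ideal R :=
    { carrier := {a | ∃ φ : (Node G s 2 b k → R) →ₗ[Rᵐᵒᵖ] R, ∀ v : Node G s 0 b k → R,
        φ (step G s E 1 b k (step G s E 0 b k v)) = a * v PUnit.unit}
      add_mem' := by
        rintro _ _ ⟨φ, hφ⟩ ⟨ψ, hψ⟩
        exact ⟨φ + ψ, fun v => by rw [LinearMap.add_apply, hφ, hψ, add_mul]⟩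
      zero_mem' := ⟨0, fun v => by simp⟩
      smul_mem' := by
        rintro c _ ⟨φ, hφ⟩
        let m : R →ₗ[Rᵐᵒᵖ] R :=
          { toFun := fun x => c * x
            map_add' := mul_add c
            map_smul' := fun r x => (mul_assoc c x r.unop).symm }
        refine ⟨m.comp φ, fun v => ?_⟩
        change c * φ _ = c * _ * _
        rw [hφ, mul_assoc] }
  have hcoord : ∀ z : Node G s 2 b k, z.label E * z.parent.label E ∈ L := fun z =>
    ⟨LinearMap.proj z, fun v => (mul_assoc _ _ _).symm⟩
  have hI : I (k + 2) ≤ L := by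
    calc I (k + 2) = I (k + 2) * I (k + 2) := (h.idem _).symm
      _ ≤ I (k + 2) * I (k + 1) := Ideal.mul_mono_right (h.anti (Nat.le_succ _))
      _ = Ideal.span (G (k + 2) : Set R) * Ideal.span (G (k + 1) : Set R) := by
        rw [h.span, h.span]
      _ ≤ L := ?_
    rw [Ideal.mul_le]
    intro r hr t ht
    have key : ∀ t ∈ Ideal.span (G (k + 1) : Set R), ∀ r ∈ I (k + 2), r * t ∈ L := by
      intro t ht
      induction ht using Submodule.span_induction with
      | mem g hg =>
        intro r hr
        rw [← h.span] at hr
        induction hr using Submodule.span_induction with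
        | mem g' hg' =>
          exact hcoord (Sum.inr (⟨g, hg⟩, Sum.inr (⟨g', hg'⟩, PUnit.unit)))
        | zero => simp
        | add a b _ _ ha hb => rw [add_mul]; exact add_mem ha hb
        | smul c a _ ha => rw [smul_eq_mul, mul_assoc]; exact L.mul_mem_left c ha
      | zero => simp
      | add a b _ _ ha hb =>
        intro r hr
        rw [mul_add]; exact add_mem (ha r hr) (hb r hr)
      | smul c a _ ha =>
        intro r hr
        rw [smul_eq_mul, ← mul_assoc]
        exact ha _ ((I (k + 2)).mul_mem_right c hr)
    exact key t ht r (h.span (k + 2) ▸ hr)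
  suffices y.label E ∈ L from this
  rcases y with ⟨i, x⟩ | ⟨g, x⟩
  · have h1 : E b (k + 1) * E b k ∈ L :=
      hcoord (Sum.inl (i, Sum.inl (⟨0, h.copies_pos _ _⟩, PUnit.unit)))
    have h2 := hI (h.left (hb.trans (Nat.le_succ k)) _ (h.mem hb))
    change E b k ∈ L
    simpa using L.sub_mem h1 h2
  · have h1 : E (k + 1) (k + 1) * g ∈ L :=
      hcoord (Sum.inr (g, Sum.inl (⟨0, h.copies_pos _ _⟩, PUnit.unit)))
    have h2 := hI (h.left le_rfl _ (h.mem_of_mem_G g))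
    change (g : R) ∈ L
    simpa using L.sub_mem h1 h2

theorem exists_functional (h : IsTower G s E I) : ∀ {d b k}, b ≤ k →
    ∀ y : Node G s (d + 1) b k,
    ∃ φ : (Node G s (d + 2) b k → R) →ₗ[Rᵐᵒᵖ] R, ∀ v : Node G s d b k → R,
      φ (step G s E (d + 1) b k (step G s E d b k v)) = step G s E d b k v y
  | 0, _, _, hb, y => h.exists_functional_root hb y
  | d + 1, b, k, hb, Sum.inl (i, x) => by
    obtain ⟨φ, hφ⟩ := exists_functional h (hb.trans (Nat.le_succ k)) x
    exact ⟨φ.comp (restrictOld G s (d + 2) b k i), fun v => hφ (restrictOld G s d b k i v)⟩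
  | d + 1, b, k, _, Sum.inr (g, x) => by
    obtain ⟨φ, hφ⟩ := exists_functional h (le_refl (k + 1)) x
    exact ⟨φ.comp (restrictNew G s (d + 2) b k g), fun v => hφ (restrictNew G s d b k g v)⟩

theorem retractable (h : IsTower G s E I) {b k : ℕ} (hb : b ≤ k) :
    Retractable (fun d => Node G s d b k → R) (fun d => step G s E d b k) := by
  intro d
  choose φ hφ using fun y => h.exists_functional (d := d) hb y
  exact ⟨LinearMap.pi φ, fun v => funext fun y => hφ y v⟩

theorem projective (h : IsTower G s E I) {b k : ℕ} (hb : b ≤ k) :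
    Module.Projective Rᵐᵒᵖ (TreeModule G s E b k) :=
  have : Module.Free Rᵐᵒᵖ R := Module.Free.of_equiv (MulOpposite.opLinearEquiv Rᵐᵒᵖ).symm
  (h.retractable hb).projective

end IsTower

end Tree

/-! ### Tree modules: decomposition, trace and reduction -/

section TreeModule

variable {R : Type u} [Ring R] {G : ℕ → Finset R} {s : ℕ → ℕ} {E : ℕ → ℕ → R}
  {I : ℕ → Ideal R} [∀ k, (I k).IsTwoSided]

open SeqColimit

theorem root_apply (b k : ℕ) (v : Node G s 0 b k → R) :
    root G s E b k (v PUnit.unit) = ι (fun d => step G s E d b k) 0 v :=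
  rfl

variable (G s E) in
/-- The terms of the sequence defining a tree module, mapped to the product of the tree modules
of the children of the root. -/
def toChildren (b k : ℕ) : ∀ d, (Node G s d b k → R) →ₗ[Rᵐᵒᵖ]
    (Fin (copies s b k) → TreeModule G s E b (k + 1)) ×
      (G (k + 1) → TreeModule G s E (k + 1) (k + 1))
  | 0 => (LinearMap.prod
      (LinearMap.pi fun i => (ι (fun d => step G s E d b (k + 1)) 0).comp
        (restrictOld G s 0 b k i))
      (LinearMap.pi fun g => (ι (fun d => step G s E d (k + 1) (k + 1)) 0).comp
        (restrictNew G s 0 b k g))).comp (step G s E 0 b k)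
  | d + 1 => LinearMap.prod
      (LinearMap.pi fun i => (ι (fun d => step G s E d b (k + 1)) d).comp
        (restrictOld G s d b k i))
      (LinearMap.pi fun g => (ι (fun d => step G s E d (k + 1) (k + 1)) d).comp
        (restrictNew G s d b k g))

theorem toChildren_step (b k : ℕ) : ∀ d (y : Node G s d b k → R),
    toChildren G s E b k (d + 1) (step G s E d b k y) = toChildren G s E b k d y
  | 0, _ => rfl
  | d + 1, y => Prod.ext
      (funext fun i => ι_step (f := fun d => step G s E d b (k + 1)) d (restrictOld G s d b k i y))
      (funext fun g => ι_step (f := fun d => step G s E d (k + 1) (k + 1)) d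
        (restrictNew G s d b k g y))

namespace IsTower

/-- A tree module is the product of the tree modules of the children of the root. -/
theorem exists_equiv_children (h : IsTower G s E I) {b k : ℕ} (hb : b ≤ k) :
    ∃ e : TreeModule G s E b k ≃ₗ[Rᵐᵒᵖ]
      (Fin (copies s b k) → TreeModule G s E b (k + 1)) ×
        (G (k + 1) → TreeModule G s E (k + 1) (k + 1)),
      (∀ d y, e (ι (fun d => step G s E d b k) (d + 1) y) =
        (fun i => ι (fun d => step G s E d b (k + 1)) d (restrictOld G s d b k i y),
          fun g => ι (fun d => step G s E d (k + 1) (k + 1)) d (restrictNew G s d b k g y))) ∧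
      ∀ r, e (root G s E b k r) = (fun _ => root G s E b (k + 1) (E b k * r),
        fun g : G (k + 1) => root G s E (k + 1) (k + 1) (g * r)) := by
  have hsurj : ∀ q, ∃ d y, toChildren G s E b k d y = q := by
    rintro ⟨p, q⟩
    have hev := (Filter.eventually_all.2 fun i => eventually_exists_ι (p i)).and
      (Filter.eventually_all.2 fun g => eventually_exists_ι (q g))
    obtain ⟨d, hp, hq⟩ := hev.exists
    choose y hy using hp
    choose z hz using hq
    exact ⟨d + 1, Sum.elim (fun x => y x.1 x.2) (fun x => z x.1 x.2),
      Prod.ext (funext hy) (funext hz)⟩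
  have hker : ∀ d y, toChildren G s E b k (d + 1) y = 0 → step G s E (d + 1) b k y = 0 := by
    intro d y hy
    have h1 : ∀ i, step G s E d b (k + 1) (restrictOld G s d b k i y) = 0 := fun i =>
      (h.retractable (hb.trans (Nat.le_succ k))).step_eq_zero
        (congrFun (congrArg Prod.fst hy) i)
    have h2 : ∀ g, step G s E d (k + 1) (k + 1) (restrictNew G s d b k g y) = 0 := fun g =>
      (h.retractable (le_refl (k + 1))).step_eq_zero (congrFun (congrArg Prod.snd hy) g)
    funext z
    rcases z with ⟨i, x⟩ | ⟨g, x⟩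
    exacts [congrFun (h1 i) x, congrFun (h2 g) x]
  obtain ⟨e, he⟩ := SeqColimit.nonempty_equiv (f := fun d => step G s E d b k)
    (toChildren G s E b k) (toChildren_step b k) hsurj (fun d y hy => by
      cases d with
      | succ d => exact hker d y hy
      | zero =>
        rw [← toChildren_step] at hy
        obtain ⟨r, hr⟩ := h.retractable hb 0
        have := hr y
        rw [hker 0 _ hy, map_zero] at this
        exact this.symm)
  exact ⟨e, fun d y => he (d + 1) y, fun r => he 0 fun _ => r⟩

theorem mulIdeal_eq_top (h : IsTower G s E I) {b k : ℕ} (hb : b ≤ k) :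
    mulIdeal (TreeModule G s E b k) (I b) = ⊤ := by
  rw [Submodule.eq_top_iff']
  intro w
  obtain ⟨d, y, rfl⟩ := exists_ι w
  rw [← ι_step]
  exact map_mem_mulIdeal _ (mem_mulIdeal_fun fun z => (I b).mul_mem_right _ (h.label_mem hb z))

/-- The root is identified with the combination of its children in which each of them is multiplied
by its label; the labels in `G (k + 1)` already lie in `I j`. -/
theorem root_mem (h : IsTower G s E I) {b k j : ℕ} (hb : b ≤ k) (hj : j ≤ k + 1) {r : R}
    (hr : E b k * r ∈ I j) : root G s E b k r ∈ mulIdeal (TreeModule G s E b k) (I j) := by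
  obtain ⟨e, -, he⟩ := h.exists_equiv_children hb
  have key : ∀ (b' k' : ℕ) {a : R}, a ∈ I j →
      root G s E b' k' a ∈ mulIdeal (TreeModule G s E b' k') (I j) := fun b' k' a ha => by
    simpa using map_mem_mulIdeal (root G s E b' k') (op_smul_mem_mulIdeal (1 : R) ha)
  refine mem_mulIdeal_of_equiv e ?_
  rw [he]
  exact mem_mulIdeal_prod (mem_mulIdeal_pi.2 fun _ => key _ _ hr)
    (mem_mulIdeal_pi.2 fun g => key _ _ ((I j).mul_mem_right _ (h.anti hj (h.mem_of_mem_G g))))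

/-- Modulo `I k`, the tree module is generated by its root: all other nodes either have level
above `k` or differ from the root only by factors that are identities modulo `I k`. -/
theorem exists_sub_root_mem (h : IsTower G s E I) : ∀ (d b k : ℕ), b ≤ k →
    ∀ y : Node G s d b k → R, ∃ r, ι (fun d => step G s E d b k) d y - root G s E b k r ∈
      mulIdeal (TreeModule G s E b k) (I k)
  | 0, b, k, _, y => ⟨y PUnit.unit, by rw [root_apply, sub_self]; exact zero_mem _⟩
  | d + 1, b, k, hb, y => by
    rcases hb.eq_or_lt with rfl | hlt
    -- a root of level `k` gives a module `W` with `W = W I k`, and any `r` will do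
    · exact ⟨0, by rw [h.mulIdeal_eq_top hb]; trivial⟩
    have hc : copies s b k = 1 := if_neg hlt.ne
    have hsub : Subsingleton (Fin (copies s b k)) := by rw [hc]; infer_instance
    have hb' := hb.trans (Nat.le_succ k)
    obtain ⟨e, he, he'⟩ := h.exists_equiv_children hb
    obtain ⟨r, hr⟩ := exists_sub_root_mem h d b (k + 1) hb'
      (restrictOld G s d b k ⟨0, h.copies_pos b k⟩ y)
    refine ⟨r, mem_mulIdeal_of_equiv e ?_⟩
    rw [map_sub, he, he']
    refine mem_mulIdeal_prod (mem_mulIdeal_pi.2 fun i => ?_) (mem_mulIdeal_pi.2 fun g => ?_)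
    · obtain rfl : i = ⟨0, h.copies_pos b k⟩ := Subsingleton.elim _ _
      have h1 := mulIdeal_mono (h.anti (Nat.le_succ k)) hr
      have h2 : root G s E b (k + 1) (r - E b k * r) ∈ mulIdeal _ (I k) := by
        refine h.root_mem hb' (Nat.le_succ_of_le (Nat.le_succ k)) ?_
        have := (I (k + 1)).mul_mem_right r (h.right hb _ (h.mem hb'))
        have h3 := (I k).neg_mem (h.anti (Nat.le_succ k) this)
        -- `E b (k + 1) * (1 - E b k)` lies in `I (k + 1)`, as `E b k` acts on `I b` from the right
        -- as an identity modulo `I (k + 1)`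
        convert h3 using 1
        noncomm_ring
      have h3 := add_mem h1 h2
      rw [map_sub, sub_add_sub_cancel] at h3
      exact h3
    · exact mulIdeal_mono (h.anti (Nat.le_succ k))
        (h.mulIdeal_eq_top (le_refl (k + 1)) ▸ Submodule.mem_top)

theorem exists_root (h : IsTower G s E I) {b k : ℕ} (hb : b ≤ k) (w : TreeModule G s E b k) :
    ∃ r, w - root G s E b k r ∈ mulIdeal (TreeModule G s E b k) (I k) := by
  obtain ⟨d, y, rfl⟩ := exists_ι w
  exact h.exists_sub_root_mem d b k hb y

theorem trace_treeModule (h : IsTower G s E I) {b k : ℕ} (hb : b ≤ k) :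
    trace R (TreeModule G s E b k) = rightIdeal (I b) := by
  refine le_antisymm (trace_le_of_mulIdeal_eq_top (h.mulIdeal_eq_top hb)) fun x hx => ?_
  obtain ⟨π, hπ⟩ := (h.retractable hb).exists_extension 0
  have hlabel : ∀ z : Node G s 1 b k, z.label E ∈ trace R (TreeModule G s E b k) := by
    intro z
    have : z.label E * 1 = _ := (congrFun (hπ fun _ => 1) z).symm
    rw [← mul_one (z.label E), this]
    exact apply_mem_trace ((LinearMap.proj z).comp π) _
  have hI : ∀ a ∈ I (k + 1), a ∈ trace R (TreeModule G s E b k) := by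
    intro a ha
    rw [← h.span] at ha
    induction ha using Submodule.span_induction with
    | mem g hg => exact hlabel (Sum.inr (⟨g, hg⟩, PUnit.unit))
    | zero => exact zero_mem _
    | add a b _ _ ha hb => exact add_mem ha hb
    | smul c a _ ha => exact mul_mem_trace c ha
  have h1 : E b k * x ∈ trace R (TreeModule G s E b k) :=
    Submodule.smul_mem _ (MulOpposite.op x)
      (hlabel (Sum.inl (⟨0, h.copies_pos b k⟩, PUnit.unit)))
  simpa using sub_mem h1 (hI _ (h.left hb x hx))

/-- Projecting to a child of the root of the same level induces `W/W I_k ≅ I_b/I_k`. -/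
theorem exists_isReductionMap (h : IsTower G s E I) {b k : ℕ} (hb : b ≤ k) :
    ∃ φ : TreeModule G s E b k →ₗ[Rᵐᵒᵖ] IdealFactor (I b) (I k), IsReductionMap (I k) φ := by
  obtain ⟨π, hπ⟩ := (h.retractable hb).exists_extension 0
  let z : Node G s 1 b k := Sum.inl (⟨0, h.copies_pos b k⟩, PUnit.unit)
  let ψ : TreeModule G s E b k →ₗ[Rᵐᵒᵖ] R := (LinearMap.proj z).comp π
  have hψ : ∀ r, ψ (root G s E b k r) = E b k * r := fun r => congrFun (hπ fun _ => r) z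
  have hmem : ∀ w, ψ w ∈ rightIdeal (I b) := fun w =>
    h.trace_treeModule hb ▸ apply_mem_trace ψ w
  have hker : ∀ w, ψ w ∈ I k → w ∈ mulIdeal (TreeModule G s E b k) (I k) := by
    intro w hw
    obtain ⟨r, hr⟩ := h.exists_root hb w
    have h1 : ψ w - E b k * r ∈ I k := by
      rw [← hψ, ← map_sub]
      exact mulIdeal_self_le (I k) (map_mem_mulIdeal ψ hr)
    have h2 : E b k * r ∈ I k := by simpa using (I k).sub_mem hw h1
    simpa using add_mem hr (h.root_mem hb (Nat.le_succ k) h2)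
  refine ⟨(Submodule.mkQ _).comp (ψ.codRestrict _ hmem), fun y => ?_, fun w hw => ?_⟩
  · obtain ⟨⟨x, hx⟩, rfl⟩ := Submodule.mkQ_surjective _ y
    refine ⟨root G s E b k x, ?_⟩
    refine (Submodule.Quotient.eq _).2 ?_
    change ψ (root G s E b k x) - x ∈ I k
    rw [hψ]
    exact h.anti (Nat.le_succ k) (h.left hb x hx)
  · exact hker w ((Submodule.Quotient.mk_eq_zero
      ((rightIdeal (I k)).submoduleOf (rightIdeal (I b)))).1 hw)

end IsTower

theorem op_smul_idealFactor (J K : Ideal R) [J.IsTwoSided] [K.IsTwoSided]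
    (y : IdealFactor J K) {a : R} (ha : a ∈ K) : MulOpposite.op a • y = 0 := by
  obtain ⟨x, rfl⟩ := Submodule.mkQ_surjective _ y
  exact (Submodule.Quotient.mk_eq_zero _).2 (K.mul_mem_left x.1 ha)

theorem isCountablyGenerated_treeModule (b k : ℕ) :
    IsCountablyGenerated R (TreeModule G s E b k) := by
  classical
  refine ⟨⋃ d, Set.range fun z : Node G s d b k =>
    ι (fun d => step G s E d b k) d (Pi.single z 1),
    Set.countable_iUnion fun d => Set.countable_range _, ?_⟩
  rw [Submodule.eq_top_iff']
  intro w
  obtain ⟨d, y, rfl⟩ := exists_ι w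
  have := Fintype.ofFinite (Node G s d b k)
  rw [← Finset.univ_sum_single y, map_sum]
  refine sum_mem fun z _ => ?_
  have hz : (Pi.single z (y z) : Node G s d b k → R) = MulOpposite.op (y z) • Pi.single z 1 := by
    simp [← Pi.single_smul]
  rw [hz, map_smul]
  exact Submodule.smul_mem _ _ (Submodule.subset_span (Set.mem_iUnion.2 ⟨d, z, rfl⟩))

end TreeModule

/-! ### Rearranging finite products -/

section Products

variable {S : Type u} [Ring S]

variable (S) in
/-- A product of binary products as a binary product of products. -/
def piProdEquiv {X : Type*} (A : X → Type v) (B : X → Type w)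
    [∀ i, AddCommGroup (A i)] [∀ i, Module S (A i)] [∀ i, AddCommGroup (B i)]
    [∀ i, Module S (B i)] : (∀ i, A i × B i) ≃ₗ[S] (∀ i, A i) × (∀ i, B i) where
  toFun f := (fun i => (f i).1, fun i => (f i).2)
  invFun p i := (p.1 i, p.2 i)
  map_add' _ _ := rfl
  map_smul' _ _ := rfl
  left_inv _ := rfl
  right_inv _ := rfl

variable (S) in
/-- Splitting off the last factor of a product over `Fin (k + 1)`. -/
def piCastSuccEquiv {k : ℕ} (A : Fin (k + 1) → Type v) [∀ i, AddCommGroup (A i)]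
    [∀ i, Module S (A i)] :
    (∀ i, A i) ≃ₗ[S] (∀ i : Fin k, A i.castSucc) × A (Fin.last k) where
  toFun f := (fun i => f i.castSucc, f (Fin.last k))
  invFun p := Fin.snocEquiv A p.swap
  map_add' _ _ := rfl
  map_smul' _ _ := rfl
  left_inv f := (Fin.snocEquiv A).right_inv f
  right_inv p := congrArg Prod.swap ((Fin.snocEquiv A).left_inv p.swap)

variable (S) in
/-- Currying of functions on a sigma type. -/
def sigmaFunEquiv {X : Type*} (κ : X → Type*) (V : Type v) [AddCommGroup V] [Module S V] :
    (∀ i, κ i → V) ≃ₗ[S] ((Σ i, κ i) → V) where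
  toFun f x := f x.1 x.2
  invFun f i x := f ⟨i, x⟩
  map_add' _ _ := rfl
  map_smul' _ _ := rfl
  left_inv _ := rfl
  right_inv _ := rfl

variable (S) in
/-- Functions on a finite type as functions on `Fin n`. -/
noncomputable def funEquivOfCard {X : Type*} [Fintype X] {n : ℕ} (h : Fintype.card X = n)
    (V : Type v) [AddCommGroup V] [Module S V] : (X → V) ≃ₗ[S] (Fin n → V) :=
  LinearEquiv.funCongrLeft S V (Fintype.equivFinOfCardEq h).symm

/-- Replacing each of the `a i` factors `A i` by `B i × V ^ m` and each of the `n` factors `A'` by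
`(B' ^ c) × V ^ m`, and collecting the factors. -/
theorem nonempty_equiv_collect {k : ℕ} {X : Type*} [Fintype X] {A : Fin k → Type v} {A' V : Type v}
    {B : Fin (k + 1) → Type v} [∀ i, AddCommGroup (A i)] [∀ i, Module S (A i)]
    [AddCommGroup A'] [Module S A'] [AddCommGroup V] [Module S V]
    [∀ i, AddCommGroup (B i)] [∀ i, Module S (B i)] {c : ℕ}
    (eA : ∀ i, Nonempty (A i ≃ₗ[S] B i.castSucc × (X → V)))
    (eA' : Nonempty (A' ≃ₗ[S] (Fin c → B (Fin.last k)) × (X → V)))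
    (a : Fin (k + 1) → ℕ) (n N : ℕ) (ha : a (Fin.last k) = c * n)
    (hN : N = Fintype.card X * (n + ∑ i : Fin k, a i.castSucc)) :
    Nonempty (((∀ i : Fin k, Fin (a i.castSucc) → A i) × (Fin n → A')) ≃ₗ[S]
      (∀ i : Fin (k + 1), Fin (a i) → B i) × (Fin N → V)) := by
  have eA := fun i => (eA i).some
  obtain ⟨eA'⟩ := eA'
  have e₁ : (∀ i : Fin k, Fin (a i.castSucc) → A i) ≃ₗ[S]
      (∀ i : Fin k, Fin (a i.castSucc) → B i.castSucc) ×
        ((Σ i : Fin k, Fin (a i.castSucc) × X) → V) :=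
    (LinearEquiv.piCongrRight fun i =>
      (LinearEquiv.piCongrRight fun _ => eA i).trans <|
        (piProdEquiv S (fun _ => B i.castSucc) fun _ => X → V).trans
          (LinearEquiv.prodCongr (.refl S _)
            (LinearEquiv.curry S V (Fin (a i.castSucc)) X).symm)).trans <|
    (piProdEquiv S (fun i : Fin k => Fin (a i.castSucc) → B i.castSucc)
      fun i => Fin (a i.castSucc) × X → V).trans
    (LinearEquiv.prodCongr (.refl S _)
      (sigmaFunEquiv S (fun i : Fin k => Fin (a i.castSucc) × X) V))
  have e₂ : (Fin n → A') ≃ₗ[S] (Fin (a (Fin.last k)) → B (Fin.last k)) × (Fin n × X → V) :=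
    (LinearEquiv.piCongrRight fun _ => eA').trans <|
    (piProdEquiv S (fun _ => Fin c → B (Fin.last k)) fun _ => X → V).trans
    (LinearEquiv.prodCongr
      ((LinearEquiv.curry S (B (Fin.last k)) (Fin n) (Fin c)).symm.trans
        (funEquivOfCard S (X := Fin n × Fin c) (by simp [ha, mul_comm]) _))
      (LinearEquiv.curry S V (Fin n) X).symm)
  have e₃ : (((Σ i : Fin k, Fin (a i.castSucc) × X) → V) × (Fin n × X → V)) ≃ₗ[S] (Fin N → V) :=
    (LinearEquiv.sumPiEquivProdPi S _ _ fun _ => V).symm.trans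
      (funEquivOfCard S (X := (Σ i : Fin k, Fin (a i.castSucc) × X) ⊕ Fin n × X) (n := N)
        (by simp [hN, ← Finset.sum_mul]; ring) V)
  exact ⟨(LinearEquiv.prodCongr e₁ e₂).trans <| (LinearEquiv.prodProdProdComm S _ _ _ _).trans <|
    LinearEquiv.prodCongr (piCastSuccEquiv S fun i => Fin (a i) → B i).symm e₃⟩

end Products

/-! ### Decomposition of the module of the whole tree -/

section Decomposition

variable {R : Type u} [Ring R] {G : ℕ → Finset R} {s : ℕ → ℕ} {E : ℕ → ℕ → R}
  {I : ℕ → Ideal R} [∀ k, (I k).IsTwoSided]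

/-- Cutting the tree at stage `k` decomposes the tree module: there are `α_i` nodes of level
`i < k` and `n_k` nodes of level `k`. -/
theorem IsTower.nonempty_equiv_stage (h : IsTower G s E I) (k : ℕ) :
    Nonempty (TreeModule G s E 0 0 ≃ₗ[Rᵐᵒᵖ]
      (∀ i : Fin k, Fin (alpha (fun i => (G i).card) s i) → TreeModule G s E i k) ×
        (Fin (counts (fun i => (G i).card) s k).1 → TreeModule G s E k k)) := by
  induction k with
  | zero =>
    exact ⟨(LinearEquiv.uniqueProd (R := Rᵐᵒᵖ)).symm.trans
      (LinearEquiv.prodCongr (LinearEquiv.refl _ _) (LinearEquiv.funUnique (Fin 1) Rᵐᵒᵖ _).symm)⟩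
  | succ k ih =>
    obtain ⟨e⟩ := ih
    have hchild : ∀ b ≤ k, ∀ c, copies s b k = c → Nonempty (TreeModule G s E b k ≃ₗ[Rᵐᵒᵖ]
        (Fin c → TreeModule G s E b (k + 1)) ×
          (G (k + 1) → TreeModule G s E (k + 1) (k + 1))) := by
      rintro b hb _ rfl
      obtain ⟨e, -⟩ := h.exists_equiv_children hb
      exact ⟨e⟩
    obtain ⟨e'⟩ := nonempty_equiv_collect (S := Rᵐᵒᵖ)
      (A := fun i : Fin k => TreeModule G s E i k) (A' := TreeModule G s E k k)
      (B := fun i : Fin (k + 1) => TreeModule G s E i (k + 1))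
      (V := TreeModule G s E (k + 1) (k + 1)) (X := G (k + 1)) (c := s k)
      (fun i => by
        obtain ⟨e⟩ := hchild i i.2.le 1 (if_neg i.2.ne)
        exact ⟨e.trans (LinearEquiv.prodCongr (LinearEquiv.funUnique (Fin 1) Rᵐᵒᵖ _)
          (LinearEquiv.refl _ _))⟩)
      (hchild k le_rfl _ (if_pos rfl))
      (fun i => alpha (fun i => (G i).card) s i) (counts (fun i => (G i).card) s k).1
      (counts (fun i => (G i).card) s (k + 1)).1 rfl (by
        rw [Fintype.card_coe, counts, counts_snd, Finset.sum_range]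
        rfl)
    exact ⟨e.trans e'⟩

/-- The reduction of the whole module modulo `I (k + 1)`: cut at stage `k + 1` and
reduce each factor; the factors of level `k + 1` vanish. -/
theorem IsTower.exists_isReductionMap_zero (h : IsTower G s E I) (k : ℕ) :
    ∃ φ : TreeModule G s E 0 0 →ₗ[Rᵐᵒᵖ] ((j : Fin (k + 1)) →
        Fin (alpha (fun i => (G i).card) s j) → IdealFactor (I j) (I (k + 1))),
      IsReductionMap (M := TreeModule G s E 0 0) (N := (j : Fin (k + 1)) →
        Fin (alpha (fun i => (G i).card) s j) → IdealFactor (I j) (I (k + 1))) (I (k + 1)) φ := by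
  obtain ⟨e⟩ := h.nonempty_equiv_stage (k + 1)
  choose φ hφ using fun j : Fin (k + 1) => h.exists_isReductionMap j.2.le
  obtain ⟨ψ, hψ⟩ : ∃ ψ : (∀ j : Fin (k + 1), Fin (alpha (fun i => (G i).card) s j) →
        TreeModule G s E j (k + 1)) →ₗ[Rᵐᵒᵖ] ((j : Fin (k + 1)) →
        Fin (alpha (fun i => (G i).card) s j) → IdealFactor (I j) (I (k + 1))),
      IsReductionMap (I (k + 1)) ψ :=
    ⟨_, IsReductionMap.pi fun j => IsReductionMap.pi fun _ => hφ j⟩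
  refine ⟨(ψ.comp (LinearMap.fst Rᵐᵒᵖ _ _)).comp e.toLinearMap, fun y => ?_, fun x hx => ?_⟩
  · obtain ⟨x, hx⟩ := hψ.1 y
    exact ⟨e.symm (x, 0), by simpa using hx⟩
  · refine mem_mulIdeal_of_equiv e (mem_mulIdeal_prod (hψ.2 _ hx) ?_)
    exact mem_mulIdeal_pi.2 fun _ => h.mulIdeal_eq_top (le_refl (k + 1)) ▸ Submodule.mem_top

end Decomposition

/-! ### The exponents determine the sequence -/

section Counting

variable {m s s' : ℕ → ℕ}

theorem counts_fst_pos (hm : ∀ k, 0 < m k) (j : ℕ) : 0 < (counts m s j).1 := by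
  induction j with
  | zero => exact one_pos
  | succ j ih => exact Nat.mul_pos (hm _) (Nat.add_pos_left ih _)

theorem counts_fst_congr {k : ℕ} (h : ∀ j < k, alpha m s j = alpha m s' j) :
    (counts m s k).1 = (counts m s' k).1 := by
  induction k with
  | zero => rfl
  | succ k ih =>
    have hsum : (counts m s k).2 = (counts m s' k).2 := by
      rw [counts_snd, counts_snd]
      exact Finset.sum_congr rfl fun i hi =>
        h i ((Finset.mem_range.1 hi).trans (Nat.lt_succ_self k))
    simp only [counts, hsum, ih fun j hj => h j (hj.trans (Nat.lt_succ_self k))]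

theorem eq_of_alpha_eq (hm : ∀ k, 0 < m k) {k : ℕ} (h : ∀ j ≤ k, alpha m s j = alpha m s' j) :
    s k = s' k := by
  have h1 := h k le_rfl
  rw [alpha, alpha, counts_fst_congr fun j hj => h j hj.le] at h1
  exact Nat.eq_of_mul_eq_mul_right (counts_fst_pos hm k) h1

end Counting

/-! ### Ideals with finitely generated reduction -/

section Finiteness

variable {R : Type u} [Ring R] {M : Type v} [AddCommGroup M] [Module Rᵐᵒᵖ M]

theorem finite_quotient_iff {S : Type u} [Ring S] {M : Type v} [AddCommGroup M] [Module S M]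
    {L : Submodule S M} : Module.Finite S (M ⧸ L) ↔ ∃ N : Submodule S M, N.FG ∧ N ⊔ L = ⊤ := by
  classical
  constructor
  · rintro ⟨T, hT⟩
    refine ⟨Submodule.span S (T.image Quotient.out : Finset M), ⟨_, rfl⟩, ?_⟩
    rw [sup_comm, ← Submodule.comap_map_mkQ, Submodule.map_span, eq_top_iff]
    intro x _
    have hx : L.mkQ x ∈ Submodule.span S (T : Set (M ⧸ L)) := hT ▸ Submodule.mem_top
    refine Submodule.span_mono (fun t ht => ?_) hx
    exact ⟨Quotient.out t, Finset.mem_coe.2 (Finset.mem_image_of_mem _ ht), Quotient.out_eq t⟩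
  · rintro ⟨N, hN, h⟩
    refine ⟨?_⟩
    have htop : N.map L.mkQ = ⊤ := by
      rw [← Submodule.range_mkQ L, ← Submodule.map_top, ← h, Submodule.map_sup,
        Submodule.mkQ_map_self, sup_bot_eq]
    exact htop ▸ hN.map L.mkQ

theorem op_smul_mem_mulIdeal_mul {I J : Ideal R} [I.IsTwoSided] {x : M}
    (hx : x ∈ mulIdeal M J) : ∀ a ∈ I, MulOpposite.op a • x ∈ mulIdeal M (J * I) := by
  induction hx using Submodule.span_induction with
  | mem x hx =>
    obtain ⟨x, b, hb, rfl⟩ := hx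
    intro a ha
    rw [smul_smul, ← MulOpposite.op_mul]
    exact op_smul_mem_mulIdeal x (Ideal.mul_mem_mul hb ha)
  | zero => simp
  | add x y _ _ hx hy =>
    intro a ha
    rw [smul_add]
    exact add_mem (hx a ha) (hy a ha)
  | smul c x _ hx =>
    intro a ha
    rw [smul_smul]
    exact hx (c.unop * a) (I.mul_mem_left _ ha)

/-- Over a right noetherian ring the two-sided ideals with finitely generated reduction are
closed under products. -/
theorem mul_mem_finiteReductionIdeals [IsNoetherian Rᵐᵒᵖ R] {I J : Ideal R}
    (hJ : J ∈ finiteReductionIdeals R M) (hI : I ∈ finiteReductionIdeals R M) :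
    J * I ∈ finiteReductionIdeals R M := by
  obtain ⟨hJ₂, hJ⟩ := hJ
  obtain ⟨hI₂, hI⟩ := hI
  have : IsNoetherianRing Rᵐᵒᵖ := isNoetherian_of_linearEquiv (MulOpposite.opLinearEquiv Rᵐᵒᵖ)
  refine ⟨inferInstance, ?_⟩
  obtain ⟨P, hP, hPI⟩ := finite_quotient_iff.1 hI
  obtain ⟨Q, hQ, hQJ⟩ := finite_quotient_iff.1 hJ
  have hQn : IsNoetherian Rᵐᵒᵖ Q := isNoetherian_of_fg_of_noetherian Q hQ
  refine finite_quotient_iff.2 ⟨P ⊔ Q ⊓ mulIdeal M I,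
    hP.sup (isNoetherian_submodule.1 hQn _ inf_le_left), ?_⟩
  rw [eq_top_iff, ← hPI, sup_assoc]
  refine sup_le_sup_left (mulIdeal_le_iff.2 fun x a ha => ?_) P
  obtain ⟨p, hp, q, hq, rfl⟩ := Submodule.mem_sup.1
    (hQJ.symm ▸ Submodule.mem_top : x ∈ Q ⊔ mulIdeal M J)
  rw [smul_add]
  exact Submodule.add_mem_sup ⟨Q.smul_mem _ hp, op_smul_mem_mulIdeal p ha⟩
    (op_smul_mem_mulIdeal_mul hq a ha)

end Finiteness

/-! ### The module is not fair sized -/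

section FairSized

variable {R : Type u} [Ring R] {G : ℕ → Finset R} {s : ℕ → ℕ} {E : ℕ → ℕ → R}
  {I : ℕ → Ideal R} [∀ k, (I k).IsTwoSided]

/-- The module with a root of level and stage `k` projects onto the module of a child of level
`k + 1`, and the kernel contains the module of a child of level `k` as a direct summand. -/
theorem IsTower.exists_projection (h : IsTower G s E I) (hG : ∀ k, (G k).Nonempty) (k : ℕ) :
    ∃ q : TreeModule G s E k k →ₗ[Rᵐᵒᵖ] TreeModule G s E (k + 1) (k + 1),
      Function.Surjective q ∧
      ∃ (j : TreeModule G s E k (k + 1) →ₗ[Rᵐᵒᵖ] TreeModule G s E k k)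
        (p : TreeModule G s E k k →ₗ[Rᵐᵒᵖ] TreeModule G s E k (k + 1)),
        ∀ w, p (j w) = w ∧ q (j w) = 0 := by
  classical
  obtain ⟨e, -⟩ := h.exists_equiv_children (le_refl k)
  let g : G (k + 1) := ⟨_, (hG (k + 1)).choose_spec⟩
  let i : Fin (copies s k k) := ⟨0, h.copies_pos k k⟩
  refine ⟨(LinearMap.proj g).comp ((LinearMap.snd Rᵐᵒᵖ _ _).comp e.toLinearMap), fun y => ?_,
    e.symm.toLinearMap.comp ((LinearMap.inl Rᵐᵒᵖ _ _).comp 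
      (LinearMap.single Rᵐᵒᵖ (fun _ => TreeModule G s E k (k + 1)) i)),
    (LinearMap.proj i).comp ((LinearMap.fst Rᵐᵒᵖ _ _).comp e.toLinearMap), fun w => ?_⟩
  · exact ⟨e.symm (0, fun _ => y), by simp⟩
  · simp

/-- Let `W k` be the tree module with a root of level and stage `k`.  The preimages of `(W k) J`
under the iterated projections `W 0 → W 1 → ⋯ → W k` form a strictly increasing chain of submodules
of `W 0` that contain `(W 0) J`. -/
theorem IsTower.not_finite_reduction (h : IsTower G s E I) (hG : ∀ k, (G k).Nonempty)
    [IsNoetherian Rᵐᵒᵖ R] (hlt : ∀ k, I (k + 1) < I k) {J : Ideal R} (hJ : ∀ k, J ≤ I k) :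
    ¬ Module.Finite Rᵐᵒᵖ (Reduction (TreeModule G s E 0 0) J) := by
  intro hfin
  have : IsNoetherianRing Rᵐᵒᵖ := isNoetherian_of_linearEquiv (MulOpposite.opLinearEquiv Rᵐᵒᵖ)
  have hnoeth : IsNoetherian Rᵐᵒᵖ (Reduction (TreeModule G s E 0 0) J) :=
    isNoetherian_of_isNoetherianRing_of_finite _ _
  choose q hq j p hjp using h.exists_projection hG
  let π : ∀ k, TreeModule G s E 0 0 →ₗ[Rᵐᵒᵖ] TreeModule G s E k k := fun k =>
    Nat.rec LinearMap.id (fun k π => (q k).comp π) k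
  have hπ : ∀ k, Function.Surjective (π k) := by
    intro k
    induction k with
    | zero => exact Function.surjective_id
    | succ k ih => exact (hq k).comp ih
  let N : ℕ → Submodule Rᵐᵒᵖ (TreeModule G s E 0 0) := fun k => (mulIdeal _ J).comap (π k)
  have hN : Monotone N := monotone_nat_of_le_succ fun k x hx => map_mem_mulIdeal (q k) hx
  have hPN : ∀ k, mulIdeal _ J ≤ N k := fun k x hx => map_mem_mulIdeal (π k) hx
  obtain ⟨k, hk⟩ := monotone_stabilizes_iff_noetherian.2 hnoeth
    ⟨fun k => (N k).map (mulIdeal (TreeModule G s E 0 0) J).mkQ,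
      fun a b hab => Submodule.map_mono (hN hab)⟩
  have hk' : N (k + 1) ≤ N k := by
    have : ((N k).map (mulIdeal (TreeModule G s E 0 0) J).mkQ).comap _ =
        ((N (k + 1)).map (mulIdeal (TreeModule G s E 0 0) J).mkQ).comap _ :=
      congrArg (Submodule.comap (mulIdeal (TreeModule G s E 0 0) J).mkQ)
        (hk (k + 1) (Nat.le_succ k))
    rw [Submodule.comap_map_mkQ, Submodule.comap_map_mkQ, sup_eq_right.2 (hPN k),
      sup_eq_right.2 (hPN (k + 1))] at this
    exact this.ge
  -- if the chain stops, the summand in the kernel of the next projection lies in `W J`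
  have htop : mulIdeal (TreeModule G s E k (k + 1)) (I (k + 1)) = ⊤ := by
    rw [Submodule.eq_top_iff']
    intro w
    obtain ⟨x, hx⟩ := hπ k (j k w)
    have hxN : x ∈ N (k + 1) := by
      change q k (π k x) ∈ mulIdeal _ J
      rw [hx, (hjp k w).2]
      exact zero_mem _
    have hj : j k w ∈ mulIdeal _ J := hx ▸ hk' hxN
    have := map_mem_mulIdeal (p k) hj
    rw [(hjp k w).1] at this
    exact mulIdeal_mono (hJ _) this
  have hle := trace_le_of_mulIdeal_eq_top htop
  rw [h.trace_treeModule (Nat.le_succ k)] at hle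
  exact (hlt k).not_ge hle

/-- A minimal ideal `J` with finitely generated reduction equals `I k * J` for every `k`, and hence
is contained in every `I k`. -/
theorem IsTower.not_isFairSized (h : IsTower G s E I) (hG : ∀ k, (G k).Nonempty)
    [IsNoetherian Rᵐᵒᵖ R] (hlt : ∀ k, I (k + 1) < I k)
    (hfin : ∀ k, Module.Finite Rᵐᵒᵖ (Reduction (TreeModule G s E 0 0) (I k))) :
    ¬ IsFairSized R (TreeModule G s E 0 0) := by
  rintro ⟨J, hJ, hmin⟩
  refine h.not_finite_reduction hG hlt (fun k => ?_) hJ.2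
  have := hJ.1
  exact (hmin (mul_mem_finiteReductionIdeals ⟨inferInstance, hfin k⟩ hJ) Ideal.mul_le_right).trans
    Ideal.mul_le_left

end FairSized

/-! ### Comparison of lengths -/

section Length

variable {R : Type u} [Ring R] {I : ℕ → Ideal R} [∀ k, (I k).IsTwoSided]

theorem sum_mul_length_eq {S : Type u} [Ring S] {n : ℕ} {A : Fin n → Type v}
    [∀ j, AddCommGroup (A j)] [∀ j, Module S (A j)] {a b : Fin n → ℕ}
    (e : (∀ j, Fin (a j) → A j) ≃ₗ[S] (∀ j, Fin (b j) → A j)) :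
    ∑ j, (a j : ℕ∞) * Module.length S (A j) = ∑ j, (b j : ℕ∞) * Module.length S (A j) := by
  simpa using e.length_eq

/-- Over the semisimple rings `R/I (k + 1)` the multiplicities of the modules `I j/I (k + 1)` are
determined one after the other by comparing lengths. -/
theorem multiplicity_unique (hss : ∀ k, IsSemisimpleRing (R ⧸ I k)) (hlt : ∀ k, I (k + 1) < I k)
    {a b : ℕ → ℕ}
    (h : ∀ k, Nonempty (((j : Fin (k + 1)) → Fin (a j) → IdealFactor (I j) (I (k + 1))) ≃ₗ[Rᵐᵒᵖ]
      ((j : Fin (k + 1)) → Fin (b j) → IdealFactor (I j) (I (k + 1))))) (k : ℕ) : a k = b k := by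
  induction k using Nat.strong_induction_on with
  | _ k ih =>
    obtain ⟨e⟩ := h k
    have hne : ∀ j, Module.length Rᵐᵒᵖ (IdealFactor (I j) (I (k + 1))) ≠ ⊤ := fun j =>
      Module.length_ne_top_iff.2 (isFiniteLength_idealFactor _ _)
    choose l hl using fun j => ENat.ne_top_iff_exists.1 (hne j)
    have hpos : l k ≠ 0 := by
      intro h0
      have h1 := hl k
      rw [h0, Nat.cast_zero, eq_comm, Module.length_eq_zero_iff,
        Submodule.Quotient.subsingleton_iff, Submodule.submoduleOf_eq_top] at h1
      exact (hlt k).not_ge h1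
    have hlen := sum_mul_length_eq (A := fun j : Fin (k + 1) => IdealFactor (I j) (I (k + 1))) e
    simp only [← hl] at hlen
    norm_cast at hlen
    rw [Fin.sum_univ_castSucc, Fin.sum_univ_castSucc] at hlen
    simp only [Fin.val_castSucc, Fin.val_last] at hlen
    rw [Finset.sum_congr rfl fun j _ => by rw [ih j j.2]] at hlen
    exact Nat.eq_of_mul_eq_mul_right (Nat.pos_of_ne_zero hpos) (Nat.add_left_cancel hlen)

end Length

end WhiteheadProj

/-! ### The modules attached to sequences of positive integers -/

theorem lemma6p6 {R : Type u} [Ring R] (I : ℕ → Ideal R) [∀ k, (I k).IsTwoSided]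
    (hanti : Antitone I)
    (hss : ∀ k, IsSemisimpleRing (R ⧸ I k))
    (hidem : ∀ k, I k * I k = I k)
    -- `G k` is a finite generating set of the left ideal `I k`
    (G : ℕ → Finset R) (hne : ∀ k, (G k).Nonempty)
    (hG : ∀ k, Ideal.span (G k : Set R) = I k) :
    -- the exponents determine the sequence
    (∀ (s s' : ℕ → ℕ+) (k : ℕ),
      (∀ j ≤ k, WhiteheadProj.alpha (fun i => (G i).card) (fun i => (s i : ℕ)) j =
        WhiteheadProj.alpha (fun i => (G i).card) (fun i => (s' i : ℕ)) j) →
      ∀ j ≤ k, s j = s' j) ∧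
    ∃ P : (ℕ → ℕ+) → ModuleCat.{u} Rᵐᵒᵖ,
      (∀ s : ℕ → ℕ+,
        WhiteheadProj.IsCountablyGenerated R (P s) ∧
        Module.Projective Rᵐᵒᵖ (P s) ∧
        WhiteheadProj.trace R (P s) = WhiteheadProj.rightIdeal (I 0) ∧
        -- (i)
        (∀ k : ℕ, Nonempty (WhiteheadProj.Reduction (P s) (I (k + 1)) ≃ₗ[Rᵐᵒᵖ]
          ((j : Fin (k + 1)) →
            Fin (WhiteheadProj.alpha (fun i => (G i).card) (fun i => (s i : ℕ)) j) →
              WhiteheadProj.IdealFactor (I j) (I (k + 1))))) ∧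
        (∀ k : ℕ, Module.Finite Rᵐᵒᵖ (WhiteheadProj.Reduction (P s) (I k))) ∧
        -- (iii)
        (∀ k : ℕ, ∃ Q : Fin (k + 1) → ModuleCat.{u} Rᵐᵒᵖ,
          Nonempty (P s ≃ₗ[Rᵐᵒᵖ] ((i : Fin (k + 1)) → Q i)) ∧
          ∀ i : Fin (k + 1), WhiteheadProj.trace R (Q i) = WhiteheadProj.rightIdeal (I i)) ∧
        -- (iv)
        (IsNoetherian Rᵐᵒᵖ R → (∀ k, I (k + 1) < I k) →
          ¬ WhiteheadProj.IsFairSized R (P s))) ∧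
      -- (ii)
      ((∀ k, I (k + 1) < I k) →
        ∀ s s' : ℕ → ℕ+, Nonempty (P s ≃ₗ[Rᵐᵒᵖ] P s') → s = s') := by
  open WhiteheadProj in
  have hm : ∀ k, 0 < (G k).card := fun k => (hne k).card_pos
  have hdet : ∀ (s s' : ℕ → ℕ+) (k : ℕ),
      (∀ j ≤ k, alpha (fun i => (G i).card) (fun i => (s i : ℕ)) j =
        alpha (fun i => (G i).card) (fun i => (s' i : ℕ)) j) → ∀ j ≤ k, s j = s' j :=
    fun s s' k h j hj => PNat.eq (eq_of_alpha_eq hm fun i hi => h i (hi.trans hj))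
  choose E hE hE' using fun b k => exists_identity_mod (I b) (I (k + 1))
  have hT : ∀ s : ℕ → ℕ+, IsTower G (fun i => (s i : ℕ)) E I := fun s =>
    { anti := hanti
      idem := hidem
      span := hG
      pos := fun k => (s k).pos
      mem := fun {b k} _ => hE b k
      left := fun {b k} _ x hx => (hE' b k x hx).1
      right := fun {b k} _ x hx => (hE' b k x hx).2 }
  have hred : ∀ (s : ℕ → ℕ+) (k : ℕ),
      Nonempty (Reduction (TreeModule G (fun i => (s i : ℕ)) E 0 0) (I (k + 1)) ≃ₗ[Rᵐᵒᵖ]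
        ((j : Fin (k + 1)) → Fin (alpha (fun i => (G i).card) (fun i => (s i : ℕ)) j) →
          IdealFactor (I j) (I (k + 1)))) := by
    intro s k
    obtain ⟨φ, hφ⟩ := (hT s).exists_isReductionMap_zero k
    exact hφ.nonempty_equiv fun y a ha =>
      funext fun j => funext fun i => op_smul_idealFactor (I j) (I (k + 1)) (y j i) ha
  have hfin : ∀ (s : ℕ → ℕ+) (k : ℕ),
      Module.Finite Rᵐᵒᵖ (Reduction (TreeModule G (fun i => (s i : ℕ)) E 0 0) (I k)) := by
    intro s k
    have h1 : Module.Finite Rᵐᵒᵖ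
        (Reduction (TreeModule G (fun i => (s i : ℕ)) E 0 0) (I (k + 1))) := by
      obtain ⟨e⟩ := hred s k
      have : ∀ j : ℕ, Module.Finite Rᵐᵒᵖ (IdealFactor (I j) (I (k + 1))) := fun j =>
        have := (isFiniteLength_iff_isNoetherian_isArtinian.1
          (isFiniteLength_idealFactor (I j) (I (k + 1)))).1
        inferInstance
      exact Module.Finite.equiv e.symm
    exact Module.Finite.of_surjective
      (Submodule.factor (mulIdeal_mono (hanti (Nat.le_succ k)))) (Submodule.factor_surjective _)
  refine ⟨hdet, fun s => ModuleCat.of Rᵐᵒᵖ (TreeModule G (fun i => (s i : ℕ)) E 0 0),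
    fun s => ⟨isCountablyGenerated_treeModule 0 0, (hT s).projective le_rfl,
      (hT s).trace_treeModule le_rfl, hred s, hfin s, fun k => ?_, fun _ hlt =>
      (hT s).not_isFairSized hne hlt (hfin s)⟩, fun hlt s s' ⟨e⟩ => ?_⟩
  · obtain ⟨e⟩ := (hT s).nonempty_equiv_stage k
    -- the number of nodes of each level at stage `k`
    let c : Fin (k + 1) → ℕ := Fin.lastCases (counts (fun i => (G i).card) (fun i => (s i : ℕ)) k).1
      fun i => alpha (fun i => (G i).card) (fun i => (s i : ℕ)) i
    have hc : ∀ i, 0 < c i := by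
      intro i
      induction i using Fin.lastCases with
      | last => simpa [c] using counts_fst_pos hm k
      | cast i =>
      simp only [c, Fin.lastCases_castSucc]
      exact Nat.mul_pos (s i).pos (counts_fst_pos hm i)
    have hcast : ∀ {n n' : ℕ} (M : Type u) [AddCommGroup M] [Module Rᵐᵒᵖ M], n = n' →
        Nonempty ((Fin n → M) ≃ₗ[Rᵐᵒᵖ] (Fin n' → M)) := by
      rintro n _ M _ _ rfl
      exact ⟨LinearEquiv.refl _ _⟩
    let Q : Fin (k + 1) → Type u := fun i =>
      Fin (c i) → TreeModule G (fun i => (s i : ℕ)) E i k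
    have e₁ : ∀ i : Fin k, Nonempty ((Fin (alpha (fun i => (G i).card) (fun i => (s i : ℕ)) i) →
        TreeModule G (fun i => (s i : ℕ)) E i k) ≃ₗ[Rᵐᵒᵖ] Q i.castSucc) := fun i =>
      hcast _ (by simp [c])
    have e₂ : Nonempty ((Fin (counts (fun i => (G i).card) (fun i => (s i : ℕ)) k).1 →
        TreeModule G (fun i => (s i : ℕ)) E k k) ≃ₗ[Rᵐᵒᵖ] Q (Fin.last k)) :=
      hcast _ (by simp [c])
    refine ⟨fun i => ModuleCat.of Rᵐᵒᵖ (Q i), ⟨e.trans <|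
      (LinearEquiv.prodCongr (LinearEquiv.piCongrRight fun i => (e₁ i).some) e₂.some).trans
        (piCastSuccEquiv Rᵐᵒᵖ Q).symm⟩, fun i => ?_⟩
    have : Nonempty (Fin (c i)) := ⟨⟨0, hc i⟩⟩
    exact trace_pi.trans ((hT s).trace_treeModule (Nat.lt_succ_iff.1 i.2))
  · have halpha := multiplicity_unique hss hlt fun k => by
      obtain ⟨e₁⟩ := hred s k
      obtain ⟨e₂⟩ := hred s' k
      obtain ⟨e₃⟩ := nonempty_reduction_equiv (I (k + 1)) e
      exact ⟨e₁.symm.trans (e₃.trans e₂)⟩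
    exact funext fun k => hdet s s' k (fun j _ => halpha j) k le_rfl
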